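/- Let $k\ge 2$ and let $A$ be an alphabet with $k$ letters; $A^*$ is the set of all finite words over $A$. A right-ideal homomorphism of $A^*$ is a map $\varphi: R\to A^*$, where $R=\mathrm{Dom}(\varphi)\subseteq A^*$ is a finitely generated right ideal ($R=PA^*$ with $P$ finite), such that $\varphi(xz)=\varphi(x)z$ for all $x\in R$, $z\in A^*$. It is an essential extension of its restriction $\Phi$ to a finitely generated right ideal $R'\subseteq R$ if $R'$ meets every right ideal that $R$ meets; every right-ideal homomorphism $\varphi$ has a unique maximum essential extension $\max(\varphi)$. The Thompson–Higman monoid $M_{k,1}$ consists of all maximum essential extensions $\max(\varphi)$, with multiplication $\varphi\cdot\psi=\max(\varphi\circ\psi)$. The submonoid $\mathrm{lep}M_{k,1}$ consists of the elements of $M_{k,1}$ of the form $\max(\psi)$, where $\psi: PA^*\to QA^*$ is a right-ideal homomorphism onto $QA^*$ with domain $PA^*$, $P$ is a finite maximal prefix code, $Q$ is a finite prefix code, and $\psi$ is length-equality preserving: $|x_1|=|x_2|$ implies $|\psi(x_1)|=|\psi(x_2)|$ for all $x_1,x_2\in\mathrm{Dom}(\psi)$. For $1\le i<j$ let $\tau_{i,j}\in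 \mathrm{lep}M_{k,1}$ be the position transposition, which exchanges the $i$-th and the $j$-th letter of every word of length at least $j$; let $\tau=\{\tau_{i,j}: 1\le i<j\}$. **Theorem (Distortion of $\mathrm{lep}M_{k,1}$ in $M_{k,1}$).** Let $\Gamma_M\subset M_{k,1}$ and $\Gamma_{\mathrm{lep}}\subset \mathrm{lep}M_{k,1}$ be finite sets such that $\Gamma_M\cup\tau$ generates the monoid $M_{k,1}$ and $\Gamma_{\mathrm{lep}}\cup\tau$ generates the monoid $\mathrm{lep}M_{k,1}$. Let $|x|_{M_{k,1}}$ and $|x|_{\mathrm{lep}M_{k,1}}$ denote the word-length of $x$ (the least length of a word that represents $x$) over $\Gamma_M\cup\tau$ and $\Gamma_{\mathrm{lep}}\cup\tau$, respectively. Then there is a constant $c\ge 1$ such that for all $x\in \mathrm{lep}M_{k,1}$ $$|x|_{\mathrm{lep}M_{k,1}}\ \le\ c\cdot\big(|x|_{M_{k,1}}\big)^2 .$$ In other words, the word-length distortion $\delta(n)=\max\{|x|_{\mathrm{lep}M_{k,1}} : x\in \mathrm{lep}M_{k,1},\ |x|_{M_{k,1}}\le n\}$ of $\mathrm{lep}M_{k,1}$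 in $M_{k,1}$ satisfies $\delta(n)\le c\,n^2$ for all real $n\ge 0$. -/

import Mathlib

open scoped NNReal ENNReal

namespace ThompsonHigman

/-! Words over the alphabet `A` are lists; `u <+: v` says that `u` is a prefix of `v`. -/

/-- A right ideal of `A*`: a set `R` of words with `R A* ⊆ R`. -/
def IsRightIdeal {A : Type*} (R : Set (List A)) : Prop :=
  ∀ x ∈ R, ∀ z : List A, x ++ z ∈ R

/-- The right ideal `P A*` generated by a set `P` of words. -/
def genIdeal {A : Type*} (P : Set (List A)) : Set (List A) :=
  {x | ∃ p ∈ P, p <+: x}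

/-- A prefix code: no element is a prefix of another element. -/
def IsPrefixCode {A : Type*} (C : Set (List A)) : Prop :=
  ∀ u ∈ C, ∀ v ∈ C, u <+: v → u = v

/-- A maximal prefix code: not a strict subset of any other prefix code. -/
def IsMaximalPrefixCode {A : Type*} (C : Set (List A)) : Prop :=
  IsPrefixCode C ∧ ∀ C' : Set (List A), IsPrefixCode C' → C ⊆ C' → C' = C

/-- `R'` is essential in `R`: `R'` intersects every right ideal that `R` intersects. -/
def IsEssentialIn {A : Type*} (R' R : Set (List A)) : Prop :=
  ∀ I : Set (List A), IsRightIdeal I → (R ∩ I).Nonempty → (R' ∩ I).Nonempty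

/-- A right-ideal homomorphism of `A*` with finitely generated domain: a partial function `φ` on
words (`none` means "undefined") whose domain is a finitely generated right ideal, with
`φ (x z) = φ (x) z` for all `x` in the domain and all words `z`. -/
@[ext]
structure RIHom (A : Type*) where
  toFun : List A → Option (List A)
  map_append : ∀ x y z : List A, toFun x = some y → toFun (x ++ z) = some (y ++ z)
  fg : ∃ P : Set (List A), P.Finite ∧ {x | ∃ y, toFun x = some y} = genIdeal P

namespace RIHom

variable {A : Type*}

/-- The domain. -/
def dom (φ : RIHom A) : Set (List A) := {x | ∃ y, φ.toFun x = some y}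

/-- The image. -/
def im (φ : RIHom A) : Set (List A) := {y | ∃ x, φ.toFun x = some y}

theorem dom_append {φ : RIHom A} {x : List A} (h : x ∈ φ.dom) (z : List A) :
    x ++ z ∈ φ.dom := by
  obtain ⟨y, hy⟩ := h
  exact ⟨_, φ.map_append _ _ z hy⟩

/-- `φ` is an essential extension of `Φ` (`Φ` is an essential restriction of `φ`): `φ` extends `Φ`
and the domain of `Φ` is essential in the domain of `φ`. -/
def IsEssentialExtension (φ Φ : RIHom A) : Prop :=
  (∀ x y, Φ.toFun x = some y → φ.toFun x = some y) ∧ IsEssentialIn Φ.dom φ.dom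

theorem IsEssentialExtension.exists_append {φ Φ : RIHom A} (h : IsEssentialExtension φ Φ)
    {x : List A} (hx : x ∈ φ.dom) : ∃ z, x ++ z ∈ Φ.dom := by
  obtain ⟨w, hw, z, rfl⟩ := h.2 {w | x <+: w}
    (fun u hu z => hu.trans (List.prefix_append u z)) ⟨x, hx, List.prefix_rfl⟩
  exact ⟨z, hw⟩

theorem isEssentialExtension_of {φ Φ : RIHom A}
    (h1 : ∀ x y, Φ.toFun x = some y → φ.toFun x = some y)
    (h2 : ∀ x ∈ φ.dom, ∃ z, x ++ z ∈ Φ.dom) : IsEssentialExtension φ Φ := by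
  refine ⟨h1, ?_⟩
  rintro I hI ⟨x, hx, hxI⟩
  obtain ⟨z, hz⟩ := h2 x hx
  exact ⟨x ++ z, hz, hI x hxI z⟩

/-- `y` is the value at `x` of the maximum essential extension of `φ`. -/
def MaxVal (φ : RIHom A) (x y : List A) : Prop :=
  (∀ z, ∃ w, x ++ z ++ w ∈ φ.dom) ∧ ∀ z v, φ.toFun (x ++ z) = some v → v = y ++ z

theorem MaxVal.unique {φ : RIHom A} {x y y' : List A} (h : φ.MaxVal x y) (h' : φ.MaxVal x y') :
    y = y' := by
  obtain ⟨w, v, hv⟩ := h.1 []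
  rw [List.append_nil] at hv
  exact List.append_cancel_right ((h.2 w v hv).symm.trans (h'.2 w v hv))

theorem MaxVal.append {φ : RIHom A} {x y : List A} (h : φ.MaxVal x y) (z : List A) :
    φ.MaxVal (x ++ z) (y ++ z) := by
  refine ⟨fun u => ?_, fun u v hv => ?_⟩
  · simpa [List.append_assoc] using h.1 (z ++ u)
  · rw [List.append_assoc] at hv ⊢
    exact h.2 _ _ hv

theorem maxVal_of_eq {φ : RIHom A} {x y : List A} (h : φ.toFun x = some y) : φ.MaxVal x y := by
  refine ⟨fun z => ⟨[], ?_⟩, fun z v hv => ?_⟩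
  · rw [List.append_nil]; exact ⟨_, φ.map_append _ _ z h⟩
  · rw [φ.map_append _ _ z h] at hv
    exact (Option.some.inj hv).symm

open Classical in
/-- The partial function underlying the maximum essential extension. -/
noncomputable def maxFun (φ : RIHom A) (x : List A) : Option (List A) :=
  if h : ∃ y, φ.MaxVal x y then some h.choose else none

theorem maxFun_eq_some {φ : RIHom A} {x y : List A} :
    φ.maxFun x = some y ↔ φ.MaxVal x y := by
  unfold maxFun
  split_ifs with h
  · rw [Option.some.injEq]
    exact ⟨fun e => e ▸ h.choose_spec, fun e => h.choose_spec.unique e⟩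
  · exact ⟨fun e => absurd e (by simp), fun e => (h ⟨y, e⟩).elim⟩

/-- The maximum essential extension `max(φ)`; see `isEssentialExtension_maxExt` and
`maxExt_isMaximum`, which characterize it. -/
noncomputable def maxExt (φ : RIHom A) : RIHom A where
  toFun := φ.maxFun
  map_append x y z h := maxFun_eq_some.2 ((maxFun_eq_some.1 h).append z)
  fg := by
    obtain ⟨P, hP, hdom⟩ := φ.fg
    refine ⟨{x | (∃ y, φ.MaxVal x y) ∧ ∃ p ∈ P, x <+: p}, ?_, ?_⟩
    · have : (⋃ p ∈ P, {x : List A | x <+: p}).Finite := by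
        refine hP.biUnion fun p _ => ?_
        refine (List.finite_toSet p.inits).subset fun x hx => ?_
        simpa using hx
      refine this.subset ?_
      rintro x ⟨-, p, hp, hx⟩
      simp only [Set.mem_iUnion]
      exact ⟨p, hp, hx⟩
    · ext x
      constructor
      · rintro ⟨y, hy⟩
        have hy := maxFun_eq_some.1 hy
        obtain ⟨w, hw⟩ := hy.1 []
        rw [List.append_nil] at hw
        have hw' : x ++ w ∈ genIdeal P := hdom ▸ hw
        obtain ⟨p, hp, hpx⟩ := hw'
        rcases List.prefix_or_prefix_of_prefix hpx (List.prefix_append x w) with h | h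
        · have hpd : p ∈ {x | ∃ y, φ.toFun x = some y} := by
            rw [hdom]; exact ⟨p, hp, List.prefix_rfl⟩
          obtain ⟨v, hv⟩ := hpd
          exact ⟨p, ⟨⟨v, maxVal_of_eq hv⟩, p, hp, List.prefix_rfl⟩, h⟩
        · exact ⟨x, ⟨⟨y, hy⟩, p, hp, h⟩, List.prefix_rfl⟩
      · rintro ⟨u, ⟨⟨y, hy⟩, -⟩, z, rfl⟩
        exact ⟨y ++ z, maxFun_eq_some.2 (hy.append z)⟩

theorem maxExt_eq_some {φ : RIHom A} {x y : List A} :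
    φ.maxExt.toFun x = some y ↔ φ.MaxVal x y := maxFun_eq_some

theorem isEssentialExtension_maxExt (φ : RIHom A) : IsEssentialExtension φ.maxExt φ := by
  refine isEssentialExtension_of (fun x y h => maxExt_eq_some.2 (maxVal_of_eq h)) ?_
  rintro x ⟨y, hy⟩
  obtain ⟨w, hw⟩ := (maxExt_eq_some.1 hy).1 []
  exact ⟨w, by simpa using hw⟩

theorem ext_some {φ ψ : RIHom A} (h : ∀ x y, φ.toFun x = some y ↔ ψ.toFun x = some y) :
    φ = ψ := by
  ext x y
  exact h x y

theorem IsEssentialExtension.maxExt_eq {φ Φ : RIHom A} (h : IsEssentialExtension φ Φ) :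
    φ.maxExt = Φ.maxExt := by
  refine ext_some fun x y => ?_
  rw [maxExt_eq_some, maxExt_eq_some]
  constructor
  · rintro ⟨h1, h2⟩
    refine ⟨fun z => ?_, fun z v hv => h2 z v (h.1 _ _ hv)⟩
    obtain ⟨w, hw⟩ := h1 z
    obtain ⟨w', hw'⟩ := h.exists_append hw
    exact ⟨w ++ w', by simpa [List.append_assoc] using hw'⟩
  · rintro ⟨h1, h2⟩
    refine ⟨fun z => ?_, fun z v hv => ?_⟩
    · obtain ⟨w, v, hv⟩ := h1 z
      exact ⟨w, v, h.1 _ _ hv⟩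
    · obtain ⟨w, u, hu⟩ := h.exists_append ⟨v, hv⟩
      have e1 := φ.map_append _ _ w hv
      rw [h.1 _ _ hu] at e1
      rw [List.append_assoc] at hu
      have e2 := h2 _ _ hu
      rw [Option.some.inj e1, ← List.append_assoc] at e2
      exact List.append_cancel_right e2

theorem maxExt_isMaximum {φ ψ : RIHom A} (h : IsEssentialExtension ψ φ) :
    IsEssentialExtension φ.maxExt ψ :=
  h.maxExt_eq ▸ ψ.isEssentialExtension_maxExt

theorem maxExt_maxExt (φ : RIHom A) : φ.maxExt.maxExt = φ.maxExt :=
  φ.isEssentialExtension_maxExt.maxExt_eq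

/-- The composition `φ ∘ ψ` of partial functions (`ψ` is applied first). -/
def comp (φ ψ : RIHom A) : RIHom A where
  toFun x := (ψ.toFun x).bind φ.toFun
  map_append x y z h := by
    obtain ⟨u, hu, hy⟩ := Option.bind_eq_some_iff.1 h
    exact Option.bind_eq_some_iff.2 ⟨_, ψ.map_append _ _ z hu, φ.map_append _ _ z hy⟩
  fg := by
    obtain ⟨P, hP, hdP⟩ := φ.fg
    obtain ⟨Q, hQ, hdQ⟩ := ψ.fg
    have key : ∀ x, (∃ y, (ψ.toFun x).bind φ.toFun = some y) ↔
        ∃ u, ψ.toFun x = some u ∧ u ∈ genIdeal P := by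
      intro x
      rw [← hdP]
      constructor
      · rintro ⟨y, hy⟩
        obtain ⟨u, hu, hy⟩ := Option.bind_eq_some_iff.1 hy
        exact ⟨u, hu, y, hy⟩
      · rintro ⟨u, hu, y, hy⟩
        exact ⟨y, Option.bind_eq_some_iff.2 ⟨u, hu, hy⟩⟩
    refine ⟨{x | (∃ u, ψ.toFun x = some u ∧ u ∈ genIdeal P) ∧
      ∃ q ∈ Q, x ∈ insert q ((fun p => q ++ p.drop ((ψ.toFun q).getD []).length) '' P)}, ?_, ?_⟩
    · have : (⋃ q ∈ Q, insert q
          ((fun p : List A => q ++ p.drop ((ψ.toFun q).getD []).length) '' P)).Finite :=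
        hQ.biUnion fun q _ => (hP.image _).insert q
      refine this.subset ?_
      rintro x ⟨-, q, hq, hx⟩
      simp only [Set.mem_iUnion]
      exact ⟨q, hq, hx⟩
    · ext x
      rw [Set.mem_ofPred_eq, key]
      constructor
      · rintro ⟨u, hu, p, hp, hpu⟩
        have hxQ : x ∈ genIdeal Q := hdQ ▸ (⟨u, hu⟩ : x ∈ {x | ∃ y, ψ.toFun x = some y})
        obtain ⟨q, hq, z, rfl⟩ := hxQ
        have hqd : q ∈ {x | ∃ y, ψ.toFun x = some y} := by
          rw [hdQ]; exact ⟨q, hq, List.prefix_rfl⟩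
        obtain ⟨v, hv⟩ := hqd
        have e := ψ.map_append _ _ z hv
        rw [hu] at e
        obtain rfl := Option.some.inj e
        rcases List.prefix_or_prefix_of_prefix hpu (List.prefix_append v z) with h | h
        · exact ⟨q, ⟨⟨v, hv, p, hp, h⟩, q, hq, Set.mem_insert _ _⟩, List.prefix_append _ _⟩
        · obtain ⟨t, rfl⟩ := h
          have ht : t <+: z := (List.prefix_append_right_inj v).1 hpu
          refine ⟨q ++ t, ⟨⟨v ++ t, ψ.map_append _ _ t hv, _, hp, List.prefix_rfl⟩, q, hq, ?_⟩, ?_⟩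
          · refine Set.mem_insert_of_mem _ ⟨v ++ t, hp, ?_⟩
            simp [hv]
          · exact (List.prefix_append_right_inj q).2 ht
      · rintro ⟨w, ⟨⟨u, hu, p, hp, hpu⟩, -⟩, z, rfl⟩
        exact ⟨u ++ z, ψ.map_append _ _ z hu, p, hp, hpu.trans (List.prefix_append u z)⟩

theorem comp_eq_some {φ ψ : RIHom A} {x y : List A} :
    (φ.comp ψ).toFun x = some y ↔ ∃ u, ψ.toFun x = some u ∧ φ.toFun u = some y :=
  Option.bind_eq_some_iff

theorem comp_assoc (φ ψ χ : RIHom A) : (φ.comp ψ).comp χ = φ.comp (ψ.comp χ) := by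
  refine ext_some fun x y => ?_
  simp only [comp_eq_some]
  constructor
  · rintro ⟨u, hu, v, hv, hy⟩
    exact ⟨v, ⟨u, hu, hv⟩, hy⟩
  · rintro ⟨v, ⟨u, hu, hv⟩, hy⟩
    exact ⟨u, hu, v, hv, hy⟩

theorem IsEssentialExtension.comp_left {φ Φ : RIHom A} (h : IsEssentialExtension φ Φ)
    (χ : RIHom A) : IsEssentialExtension (χ.comp φ) (χ.comp Φ) := by
  refine isEssentialExtension_of (fun x y hy => ?_) ?_
  · obtain ⟨u, hu, hy⟩ := comp_eq_some.1 hy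
    exact comp_eq_some.2 ⟨u, h.1 _ _ hu, hy⟩
  · rintro x ⟨y, hy⟩
    obtain ⟨u, hu, hy⟩ := comp_eq_some.1 hy
    obtain ⟨z, v, hv⟩ := h.exists_append ⟨u, hu⟩
    have e := φ.map_append _ _ z hu
    rw [h.1 _ _ hv] at e
    obtain rfl := Option.some.inj e
    exact ⟨z, y ++ z, comp_eq_some.2 ⟨_, hv, χ.map_append _ _ z hy⟩⟩

theorem IsEssentialExtension.comp_right {φ Φ : RIHom A} (h : IsEssentialExtension φ Φ)
    (χ : RIHom A) : IsEssentialExtension (φ.comp χ) (Φ.comp χ) := by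
  refine isEssentialExtension_of (fun x y hy => ?_) ?_
  · obtain ⟨u, hu, hy⟩ := comp_eq_some.1 hy
    exact comp_eq_some.2 ⟨u, hu, h.1 _ _ hy⟩
  · rintro x ⟨y, hy⟩
    obtain ⟨u, hu, hy⟩ := comp_eq_some.1 hy
    obtain ⟨z, v, hv⟩ := h.exists_append ⟨y, hy⟩
    exact ⟨z, v, comp_eq_some.2 ⟨_, χ.map_append _ _ z hu, hv⟩⟩

theorem maxExt_comp_maxExt (φ ψ : RIHom A) :
    (φ.maxExt.comp ψ.maxExt).maxExt = (φ.comp ψ).maxExt :=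
  (ψ.isEssentialExtension_maxExt.comp_left φ.maxExt).maxExt_eq.trans
    (φ.isEssentialExtension_maxExt.comp_right ψ).maxExt_eq

/-- The identity map of `A*`. -/
def id (A : Type*) : RIHom A where
  toFun := some
  map_append x y z h := by rw [Option.some.inj h]
  fg := ⟨{[]}, Set.finite_singleton _, by ext x; simp [genIdeal]⟩

/-- The position transposition `τ_{i,j}`, `1 ≤ i < j`: it is defined on the words of length at
least `j`, and exchanges the `i`-th and the `j`-th letter (positions are counted from `1`). -/
def transposition (A : Type*) [Finite A] (i j : ℕ) (hi : 1 ≤ i) (hij : i < j) : RIHom A where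
  toFun x :=
    if h : j ≤ x.length then
      some ((x.set (i - 1) (x[j - 1]'(by omega))).set (j - 1) (x[i - 1]'(by omega)))
    else none
  map_append x y z h := by
    split_ifs at h with hj
    rw [dif_pos (by rw [List.length_append]; omega)]
    obtain rfl := Option.some.inj h
    congr 1
    rw [List.getElem_append_left (by omega), List.getElem_append_left (by omega),
      List.set_append_left _ _ (by omega), List.set_append_left _ _ (by simp; omega)]
  fg := by
    refine ⟨{x | x.length = j}, List.finite_length_eq A j, ?_⟩
    ext x
    constructor
    · rintro ⟨y, hy⟩
      have hj : j ≤ x.length := by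
        by_contra hc
        rw [dif_neg hc] at hy
        exact Option.some_ne_none _ hy.symm
      exact ⟨x.take j, by simpa using hj, List.take_prefix j x⟩
    · rintro ⟨p, hp, hpx⟩
      have hj : j ≤ x.length := by
        have := hpx.length_le
        simp only [Set.mem_ofPred_eq] at hp
        omega
      exact ⟨_, dif_pos hj⟩

/-- Length-equality preservation: arguments of equal length have values of equal length. -/
def IsLengthEqualityPreserving (φ : RIHom A) : Prop :=
  ∀ x₁ x₂ y₁ y₂ : List A, φ.toFun x₁ = some y₁ → φ.toFun x₂ = some y₂ →
    x₁.length = x₂.length → y₁.length = y₂.length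

end RIHom

/-! ### Finitely generated right ideals and finite prefix codes -/

theorem exists_prefixCode {A : Type*} {P : Set (List A)} (hP : P.Finite) :
    ∃ Q : Set (List A), Q.Finite ∧ IsPrefixCode Q ∧ genIdeal P = genIdeal Q := by
  refine ⟨{x | x ∈ P ∧ ∀ p ∈ P, p <+: x → p = x}, hP.subset fun x hx => hx.1,
    fun u hu v hv h => hv.2 u hu.1 h, ?_⟩
  ext x
  constructor
  · rintro ⟨p, hp, hpx⟩
    induction hn : p.length using Nat.strong_induction_on generalizing p with
    | _ n ih =>
      by_cases h : ∀ q ∈ P, q <+: p → q = p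
      · exact ⟨p, ⟨hp, h⟩, hpx⟩
      · push Not at h
        obtain ⟨q, hq, hqp, hne⟩ := h
        refine ih q.length ?_ q hq (hqp.trans hpx) rfl
        rw [← hn]
        exact lt_of_le_of_ne hqp.length_le fun e => hne (hqp.eq_of_length e)
  · rintro ⟨p, hp, hpx⟩
    exact ⟨p, hp.1, hpx⟩

theorem IsPrefixCode.isMaximal_iff {A : Type*} {Q : Set (List A)} (hQ : IsPrefixCode Q) :
    IsMaximalPrefixCode Q ↔ ∀ x, ∃ z, x ++ z ∈ genIdeal Q := by
  constructor
  · rintro ⟨-, hmax⟩ x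
    by_contra! hx
    have hcode : IsPrefixCode (insert x Q) := by
      rintro u (rfl | hu) v (rfl | hv) huv
      · rfl
      · obtain ⟨z, rfl⟩ := huv
        exact (hx z ⟨_, hv, List.prefix_rfl⟩).elim
      · exact (hx [] ⟨u, hu, by simpa using huv⟩).elim
      · exact hQ u hu v hv huv
    have hxQ : x ∈ Q := hmax _ hcode (Set.subset_insert x Q) ▸ Set.mem_insert x Q
    exact hx [] ⟨x, hxQ, by simp⟩
  · intro hess
    refine ⟨hQ, fun C hC hQC => Set.Subset.antisymm (fun x hx => ?_) hQC⟩
    obtain ⟨z, q, hq, hqx⟩ := hess x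
    rcases List.prefix_or_prefix_of_prefix hqx (List.prefix_append x z) with h | h
    · exact hC q (hQC hq) x hx h ▸ hq
    · exact (hC x hx q (hQC hq) h) ▸ hq

theorem RIHom.exists_im_eq {A : Type*} (φ : RIHom A) :
    ∃ Q : Set (List A), Q.Finite ∧ IsPrefixCode Q ∧ φ.im = genIdeal Q := by
  obtain ⟨P, hP, hd⟩ := φ.fg
  obtain ⟨Q, hQ, hc, he⟩ := exists_prefixCode (hP.image fun p => (φ.toFun p).getD [])
  refine ⟨Q, hQ, hc, he ▸ ?_⟩
  have hPd : ∀ p ∈ P, ∃ v, φ.toFun p = some v := fun p hp => by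
    have : p ∈ {x | ∃ y, φ.toFun x = some y} := by rw [hd]; exact ⟨p, hp, List.prefix_rfl⟩
    exact this
  ext y
  constructor
  · rintro ⟨x, hx⟩
    have hxP : x ∈ genIdeal P := hd ▸ (⟨y, hx⟩ : x ∈ {x | ∃ y, φ.toFun x = some y})
    obtain ⟨p, hp, z, rfl⟩ := hxP
    obtain ⟨v, hv⟩ := hPd p hp
    rw [φ.map_append _ _ z hv] at hx
    obtain rfl := Option.some.inj hx
    exact ⟨v, ⟨p, hp, by simp [hv]⟩, List.prefix_append v z⟩
  · rintro ⟨_, ⟨p, hp, rfl⟩, z, rfl⟩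
    obtain ⟨v, hv⟩ := hPd p hp
    exact ⟨p ++ z, by simpa [hv] using φ.map_append _ _ z hv⟩

/-- The Thompson-Higman monoid `M_{k,1}`, where `k` is the number of letters of `A`: the maximum
essential extensions of homomorphisms between finitely generated right ideals of `A*`. -/
def M (A : Type*) : Type _ := {φ : RIHom A // ∃ ψ : RIHom A, φ = ψ.maxExt}

/-- The element `max(φ)` of `M_{k,1}` represented by `φ`. -/
noncomputable def M.mk {A : Type*} (φ : RIHom A) : M A := ⟨φ.maxExt, φ, rfl⟩

theorem M.mk_val {A : Type*} (f : M A) : M.mk f.1 = f := by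
  obtain ⟨_, ψ, rfl⟩ := f
  exact Subtype.ext ψ.maxExt_maxExt

/-- Multiplication in `M_{k,1}`: composition followed by maximum essential extension. -/
noncomputable instance (A : Type*) : Mul (M A) := ⟨fun f g => M.mk (f.1.comp g.1)⟩

theorem M.mk_mul_mk {A : Type*} (φ ψ : RIHom A) : M.mk φ * M.mk ψ = M.mk (φ.comp ψ) :=
  Subtype.ext (RIHom.maxExt_comp_maxExt φ ψ)

noncomputable instance (A : Type*) : Monoid (M A) where
  one := M.mk (RIHom.id A)
  mul_assoc f g h := by
    rw [← M.mk_val f, ← M.mk_val g, ← M.mk_val h]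
    simp only [M.mk_mul_mk, RIHom.comp_assoc]
  one_mul f := by
    rw [← M.mk_val f]
    refine (M.mk_mul_mk _ _).trans (congrArg M.mk (RIHom.ext_some fun x y => ?_))
    rw [RIHom.comp_eq_some]
    exact ⟨fun ⟨u, hu, e⟩ => hu.trans e, fun h => ⟨y, h, rfl⟩⟩
  mul_one f := by
    rw [← M.mk_val f]
    refine (M.mk_mul_mk _ _).trans (congrArg M.mk (RIHom.ext_some fun x y => ?_))
    rw [RIHom.comp_eq_some]
    exact ⟨fun ⟨u, hu, e⟩ => (Option.some.inj hu) ▸ e, fun h => ⟨x, rfl, h⟩⟩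

theorem M.one_def {A : Type*} : (1 : M A) = M.mk (RIHom.id A) := rfl

/-- The set `{τ_{i,j} : 1 ≤ i < j}` of all position transpositions. -/
def transpositions (A : Type*) [Finite A] : Set (M A) :=
  {f | ∃ (i j : ℕ) (hi : 1 ≤ i) (hij : i < j), f = M.mk (RIHom.transposition A i j hi hij)}

/-- The submonoid `lepM_{k,1}` of `M_{k,1}`: the elements represented by some
length-equality preserving homomorphism `ψ : P A* → Q A*`, where `P` and `Q` are finite prefix
codes and `P` is maximal. -/
def lepM (A : Type*) : Submonoid (M A) where
  carrier := {f | ∃ ψ : RIHom A, f = M.mk ψ ∧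
    (∃ P : Set (List A), P.Finite ∧ IsMaximalPrefixCode P ∧ ψ.dom = genIdeal P) ∧
    (∃ Q : Set (List A), Q.Finite ∧ IsPrefixCode Q ∧ ψ.im = genIdeal Q) ∧
    ψ.IsLengthEqualityPreserving}
  one_mem' := by
    refine ⟨RIHom.id A, rfl, ⟨{[]}, Set.finite_singleton _, ?_, ?_⟩, RIHom.exists_im_eq _, ?_⟩
    · refine (IsPrefixCode.isMaximal_iff ?_).2 fun x => ⟨[], [], rfl, List.nil_prefix⟩
      rintro u hu v hv -
      exact hu.trans hv.symm
    · ext x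
      exact ⟨fun _ => ⟨[], rfl, List.nil_prefix⟩, fun _ => ⟨x, rfl⟩⟩
    · intro x₁ x₂ y₁ y₂ h1 h2 h
      rwa [← Option.some.inj h1, ← Option.some.inj h2]
  mul_mem' := by
    rintro _ _ ⟨φ, rfl, ⟨P, hP, hPm, hPd⟩, -, hφ⟩ ⟨ψ, rfl, ⟨Q, hQ, hQm, hQd⟩, -, hψ⟩
    refine ⟨φ.comp ψ, M.mk_mul_mk φ ψ, ?_, RIHom.exists_im_eq _, ?_⟩
    · obtain ⟨S, hS, hSd⟩ := (φ.comp ψ).fg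
      obtain ⟨R, hR, hRc, hRe⟩ := exists_prefixCode hS
      refine ⟨R, hR, hRc.isMaximal_iff.2 fun x => ?_, hSd.trans hRe⟩
      rw [← hRe, ← hSd]
      obtain ⟨z, hz⟩ := hQm.1.isMaximal_iff.1 hQm x
      rw [← hQd] at hz
      obtain ⟨u, hu⟩ := hz
      obtain ⟨w, hw⟩ := hPm.1.isMaximal_iff.1 hPm u
      rw [← hPd] at hw
      obtain ⟨v, hv⟩ := hw
      refine ⟨z ++ w, v, RIHom.comp_eq_some.2 ⟨u ++ w, ?_, hv⟩⟩
      rw [← List.append_assoc]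
      exact ψ.map_append _ _ w hu
    · intro x₁ x₂ y₁ y₂ h1 h2 h
      obtain ⟨u₁, hu1, hy1⟩ := RIHom.comp_eq_some.1 h1
      obtain ⟨u₂, hu2, hy2⟩ := RIHom.comp_eq_some.1 h2
      exact hφ _ _ _ _ hy1 hy2 (hψ _ _ _ _ hu1 hu2 h)

/-- The word-length `|x|` of an element `x` of a monoid over a set `S`: the least length of a word
over `S` that represents `x`. (The value is meaningful if `S` generates `x`.) -/
noncomputable def wordLength {G : Type*} [Monoid G] (S : Set G) (x : G) : ℕ :=
  sInf {n : ℕ | ∃ w : List G, (∀ s ∈ w, s ∈ S) ∧ w.prod = x ∧ w.length = n}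

/-- The distortion of `ℓ₁` with respect to `ℓ₂`: the function
`n ↦ max {ℓ₁ g : g ∈ G, ℓ₂ g ≤ n}`, as a supremum in `[0, ∞]`. -/
noncomputable def distortion {G : Type*} (ℓ₁ ℓ₂ : G → ℝ≥0) (n : ℝ≥0) : ℝ≥0∞ :=
  ⨆ (g : G) (_ : ℓ₂ g ≤ n), (ℓ₁ g : ℝ≥0∞)

end ThompsonHigman

/-!
An element of `lepM_{k,1}` that is a product of `N` generators of `M_{k,1}` is simulated by a
product of `O(N²)` generators of `lepM_{k,1}`.

Elements of `M_{k,1}` act on infinite words by changing a finite prefix (`RIHom.Acts`, where the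
change of length is recorded). Passing to the maximum essential extension does not affect this
action, multiplication becomes composition, and an element that acts everywhere is determined by
its action (`M.ext_acts`). The elements of `lepM_{k,1}` are those that act everywhere with a change
of length that does not depend on the infinite word; only one direction is needed, namely
`exists_acts_of_mem_lepM`.

A fixed map of finitely many letters, followed by the rest of the word, lies in `lepM_{k,1}`.
Conjugation by boundedly many transpositions moves it to arbitrary positions, so it can be applied
anywhere at bounded cost (`exists_realizes_gate`). These are the gates of a circuit, and insertion
and deletion of `m` letters at the front cost `O(m)`.

A generator `γ` of `M_{k,1}` may change the length by an amount that depends on the argument, hence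
is not available as a gate. The remedy is to keep the right end of the current word in place on a
tape, and to let its left end, the offset `p`, move. The offset is kept in unary: there are
`D = O(N)` flags, of which only the one of `p` is raised (`Stores`). A transposition acts on the
positions `p + i` and `p + j`; it is simulated by one conditional exchange for each of the `O(N)`
values of `p` (`exists_realizes_stored_swap`). The cost does not depend on `i` and `j`, although
these are unbounded. A generator `γ` of the finite set is simulated by one conditional rewriting of
a window of bounded width for each value of `p` (`exists_realizes_stored_map`). So each of the `N`
steps costs `O(N)`. At the end the offset is the same for all infinite words because the product
lies in `lepM_{k,1}`; therefore the flags and the unused part of the tape form a prefix of fixed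
length, which is deleted (`exists_wordLength_le_mul_sq`).
-/

open scoped NNReal ENNReal

namespace ThompsonHigman

variable {A : Type*}

/-! ### The action on infinite words -/

/-- The prefix of length `m` of the infinite word `α`. -/
def pre (α : ℕ → A) (m : ℕ) : List A := (List.range m).map α

@[simp] theorem length_pre (α : ℕ → A) (m : ℕ) : (pre α m).length = m := by simp [pre]

@[simp] theorem getElem_pre (α : ℕ → A) (m i : ℕ) (h : i < (pre α m).length) :
    (pre α m)[i] = α i := by simp [pre]

theorem pre_add (α : ℕ → A) (m t : ℕ) :
    pre α (m + t) = pre α m ++ pre (fun i => α (m + i)) t := by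
  simp [pre, List.range_add, Function.comp_def]

theorem pre_prefix (α : ℕ → A) {m n : ℕ} (h : m ≤ n) : pre α m <+: pre α n := by
  obtain ⟨t, rfl⟩ := Nat.exists_eq_add_of_le h
  exact pre_add α m t ▸ List.prefix_append _ _

theorem eq_pre {α : ℕ → A} {x : List A} (h : ∀ i (hi : i < x.length), x[i] = α i) :
    x = pre α x.length :=
  List.ext_getElem (by simp) fun i h1 h2 => by simp [h i h1]

/-- The infinite word `x ζ`, where `x` is a finite and `ζ` an infinite word. -/
def cat (x : List A) (ζ : ℕ → A) (i : ℕ) : A :=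
  if h : i < x.length then x[i] else ζ (i - x.length)

theorem pre_cat (x : List A) (ζ : ℕ → A) : pre (cat x ζ) x.length = x :=
  (eq_pre fun i hi => by simp [cat, hi]).symm

@[simp] theorem cat_length_add (x : List A) (ζ : ℕ → A) (i : ℕ) :
    cat x ζ (x.length + i) = ζ i := by simp [cat]

namespace RIHom

/-- `φ` takes the infinite word `α` to the infinite word `β` by replacing a prefix of `α` with a
word that is longer by `d` letters (`d` may be negative). -/
def Acts (φ : RIHom A) (α β : ℕ → A) (d : ℤ) : Prop :=
  ∃ m n : ℕ, φ.toFun (pre α m) = some (pre β n) ∧ (∀ i, β (n + i) = α (m + i)) ∧ (n : ℤ) = m + d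

theorem toFun_pre_add {φ : RIHom A} {α β : ℕ → A} {m n : ℕ}
    (h : φ.toFun (pre α m) = some (pre β n)) (h' : ∀ i, β (n + i) = α (m + i)) (t : ℕ) :
    φ.toFun (pre α (m + t)) = some (pre β (n + t)) := by
  rw [pre_add, pre_add, φ.map_append _ _ _ h]
  simp only [h']

theorem Acts.exists_ge {φ : RIHom A} {α β : ℕ → A} {d : ℤ} (h : φ.Acts α β d) (L : ℕ) :
    ∃ m n : ℕ, L ≤ m ∧ L ≤ n ∧ φ.toFun (pre α m) = some (pre β n) ∧
      (∀ i, β (n + i) = α (m + i)) ∧ (n : ℤ) = m + d := by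
  obtain ⟨m, n, h1, h2, h3⟩ := h
  refine ⟨m + L, n + L, by omega, by omega, toFun_pre_add h1 h2 L, fun i => ?_, by push_cast; omega⟩
  rw [add_assoc, h2, add_assoc]

theorem acts_of_eq {φ : RIHom A} {x y : List A} (h : φ.toFun x = some y) (ζ : ℕ → A) :
    φ.Acts (cat x ζ) (cat y ζ) (y.length - x.length) :=
  ⟨x.length, y.length, by rw [pre_cat, pre_cat, h], by simp, by ring⟩

theorem eq_cat_pre (α : ℕ → A) (m : ℕ) : α = cat (pre α m) (fun i => α (m + i)) := by
  funext i
  unfold cat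
  split_ifs with h
  · simp
  · simp only [length_pre] at h ⊢
    congr 1
    omega

theorem Acts.unique {φ : RIHom A} {α β β' : ℕ → A} {d d' : ℤ} (h : φ.Acts α β d)
    (h' : φ.Acts α β' d') : β = β' ∧ d = d' := by
  obtain ⟨m, n, h1, h2, h3⟩ := h
  obtain ⟨m', n', -, -, h1', h2', h3'⟩ := h'.exists_ge 0
  have e1 := toFun_pre_add h1 h2 m'
  have e2 := toFun_pre_add h1' h2' m
  rw [add_comm m' m, e1, Option.some.injEq] at e2
  have hn : n + m' = n' + m := by simpa using congrArg List.length e2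
  refine ⟨funext fun i => ?_, by omega⟩
  by_cases hi : i < n + m'
  · have := List.getElem_of_eq e2 (i := i) (by simpa using hi)
    simpa using this
  · obtain ⟨t, rfl⟩ := Nat.exists_eq_add_of_le (not_lt.1 hi)
    rw [show β' _ = β' (n' + (m + t)) by rw [hn, add_assoc], add_assoc, h2, h2']
    congr 1
    omega

/-- A word that is long enough and has an extension in the domain lies in the domain. -/
theorem exists_mem_dom_of_append (φ : RIHom A) :
    ∃ L, ∀ x z : List A, L ≤ x.length → x ++ z ∈ φ.dom → x ∈ φ.dom := by
  obtain ⟨P, hP, hd⟩ := φ.fg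
  obtain ⟨L, hL⟩ := (hP.image List.length).bddAbove
  refine ⟨L, fun x z hx hxz => ?_⟩
  have hxz' : x ++ z ∈ genIdeal P := hd ▸ hxz
  obtain ⟨p, hp, hpx⟩ := hxz'
  have : x ∈ genIdeal P := ⟨p, hp, List.prefix_of_prefix_length_le hpx (List.prefix_append x z)
    ((hL ⟨p, hp, rfl⟩).trans hx)⟩
  rwa [← hd] at this

theorem acts_maxExt {φ : RIHom A} {α β : ℕ → A} {d : ℤ} :
    φ.maxExt.Acts α β d ↔ φ.Acts α β d := by
  constructor
  · intro h
    obtain ⟨L, hL⟩ := φ.exists_mem_dom_of_append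
    obtain ⟨m, n, hm, -, h1, h2, h3⟩ := h.exists_ge L
    obtain ⟨w, hw⟩ := (maxExt_eq_some.1 h1).1 []
    rw [List.append_nil] at hw
    obtain ⟨v, hv⟩ := hL _ _ (by simpa using hm) hw
    have := (maxExt_eq_some.1 h1).2 [] v (by simpa using hv)
    rw [List.append_nil] at this
    exact ⟨m, n, this ▸ hv, h2, h3⟩
  · rintro ⟨m, n, h1, h2, h3⟩
    exact ⟨m, n, maxExt_eq_some.2 (maxVal_of_eq h1), h2, h3⟩

theorem acts_comp {φ ψ : RIHom A} {α γ : ℕ → A} {d : ℤ} :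
    (φ.comp ψ).Acts α γ d ↔ ∃ β d₁ d₂, ψ.Acts α β d₁ ∧ φ.Acts β γ d₂ ∧ d = d₁ + d₂ := by
  constructor
  · rintro ⟨m, n, h1, h2, h3⟩
    obtain ⟨u, hu, hv⟩ := comp_eq_some.1 h1
    have hψ := acts_of_eq hu (fun i => α (m + i))
    have hφ := acts_of_eq hv (fun i => α (m + i))
    rw [← eq_cat_pre] at hψ
    have e : cat (pre γ n) (fun i => α (m + i)) = γ := by
      simp only [← h2]
      exact (eq_cat_pre γ n).symm
    rw [e] at hφ
    refine ⟨_, _, _, hψ, hφ, ?_⟩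
    simp only [length_pre]
    omega
  · rintro ⟨β, d₁, d₂, ⟨m, n, h1, h2, h3⟩, ⟨m', n', h1', h2', h3'⟩, rfl⟩
    refine ⟨m + m', n' + n, comp_eq_some.2 ⟨_, toFun_pre_add h1 h2 m', ?_⟩, fun i => ?_,
      by push_cast; omega⟩
    · rw [add_comm n m']
      exact toFun_pre_add h1' h2' n
    · rw [add_assoc, h2', ← add_assoc, add_comm m' n, add_assoc, h2, add_assoc]

end RIHom

theorem acts_mul {f g : M A} {α γ : ℕ → A} {d : ℤ} :
    (f * g).1.Acts α γ d ↔ ∃ β d₁ d₂, g.1.Acts α β d₁ ∧ f.1.Acts β γ d₂ ∧ d = d₁ + d₂ :=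
  RIHom.acts_maxExt.trans RIHom.acts_comp

theorem acts_one (α : ℕ → A) : (1 : M A).1.Acts α α 0 :=
  RIHom.acts_maxExt.2 ⟨0, 0, rfl, by simp, by simp⟩

theorem acts_one_iff {α β : ℕ → A} {d : ℤ} : (1 : M A).1.Acts α β d ↔ β = α ∧ d = 0 := by
  constructor
  · exact fun h => h.unique (acts_one α)
  · rintro ⟨rfl, rfl⟩
    exact acts_one _

/-- An element of `M_{k,1}` that acts everywhere is determined by its action on infinite words. -/
theorem M.ext_acts [Inhabited A] {f g : M A} (h : ∀ α, ∃ β d, f.1.Acts α β d ∧ g.1.Acts α β d) :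
    f = g := by
  have key : ∀ f g : M A, (∀ α, ∃ β d, f.1.Acts α β d ∧ g.1.Acts α β d) →
      ∀ x y, f.1.toFun x = some y → g.1.toFun x = some y := by
    intro f g h x y hxy
    rw [← M.mk_val g]
    refine RIHom.maxExt_eq_some.2 ⟨fun z => ?_, fun z v hv => ?_⟩
    · obtain ⟨β, d, -, hg⟩ := h (cat (x ++ z) fun _ => default)
      obtain ⟨m, n, hm, -, h1, -, -⟩ := hg.exists_ge (x ++ z).length
      obtain ⟨w, hw⟩ := pre_prefix (cat (x ++ z) fun _ => default) hm
      rw [pre_cat] at hw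
      exact ⟨w, _, hw ▸ h1⟩
    · obtain ⟨β, d, hf, hg⟩ := h (cat (x ++ z) fun _ => default)
      obtain ⟨e1, e2⟩ := hf.unique (RIHom.acts_of_eq (f.1.map_append _ _ z hxy) _)
      obtain ⟨e3, e4⟩ := hg.unique (RIHom.acts_of_eq hv _)
      have hl : v.length = (y ++ z).length := by omega
      rw [← pre_cat v fun _ => default, ← e3, e1, hl, pre_cat]
  exact Subtype.ext (RIHom.ext_some fun x y =>
    ⟨key f g h x y, key g f (fun α => (h α).imp fun β ⟨d, h1, h2⟩ => ⟨d, h2, h1⟩) x y⟩)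

/-- The elements of `lepM_{k,1}` act on all infinite words, with a constant change of length. -/
theorem exists_acts_of_mem_lepM [Inhabited A] {f : M A} (hf : f ∈ lepM A) :
    ∃ d, ∀ α, ∃ β, f.1.Acts α β d := by
  obtain ⟨ψ, rfl, ⟨P, hP, hPm, hPd⟩, -, hψ⟩ := hf
  obtain ⟨L, hL⟩ := ψ.exists_mem_dom_of_append
  have hdom : ∀ α : ℕ → A, pre α L ∈ ψ.dom := fun α => by
    obtain ⟨z, hz⟩ := (hPm.1.isMaximal_iff).1 hPm (pre α L)
    exact hL _ z (by simp) (hPd ▸ hz)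
  obtain ⟨y₀, hy₀⟩ := hdom fun _ => default
  refine ⟨y₀.length - L, fun α => ?_⟩
  obtain ⟨y, hy⟩ := hdom α
  have hl : y.length = y₀.length := hψ _ _ _ _ hy hy₀ (by simp)
  have := RIHom.acts_of_eq hy (fun i => α (L + i))
  rw [← RIHom.eq_cat_pre, hl, length_pre] at this
  exact ⟨_, RIHom.acts_maxExt.2 this⟩

/-- Replacement of the prefix of length `r` by its image under a map `f` from the words of length
`r` to the words of length `s`. -/
def RIHom.prefixMap [Finite A] (r s : ℕ) (f : List A → List A)
    (_ : ∀ u, u.length = r → (f u).length = s) : RIHom A where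
  toFun x := if r ≤ x.length then some (f (x.take r) ++ x.drop r) else none
  map_append x y z h := by
    split_ifs at h with hr
    rw [if_pos (by rw [List.length_append]; omega), ← Option.some.inj h,
      List.take_append_of_le_length hr, List.drop_append_of_le_length hr, List.append_assoc]
  fg := by
    refine ⟨{x | x.length = r}, List.finite_length_eq A r, ?_⟩
    ext x
    constructor
    · rintro ⟨y, hy⟩
      have hr : r ≤ x.length := by
        by_contra hc
        rw [if_neg hc] at hy
        exact Option.some_ne_none _ hy.symm
      exact ⟨x.take r, by simpa using hr, List.take_prefix r x⟩
    · rintro ⟨p, hp, hpx⟩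
      have hr : r ≤ x.length := by
        have := hpx.length_le
        simp only [Set.mem_ofPred_eq] at hp
        omega
      exact ⟨_, if_pos hr⟩

theorem mk_prefixMap_mem_lepM [Finite A] [Inhabited A] {r s : ℕ} {f : List A → List A}
    (hf : ∀ u, u.length = r → (f u).length = s) : M.mk (RIHom.prefixMap r s f hf) ∈ lepM A := by
  have hd : (RIHom.prefixMap r s f hf).dom = genIdeal {x | x.length = r} := by
    ext x
    constructor
    · rintro ⟨y, hy⟩
      have hr : r ≤ x.length := by
        by_contra hc
        rw [RIHom.prefixMap] at hy
        simp [hc] at hy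
      exact ⟨x.take r, by simpa using hr, List.take_prefix r x⟩
    · rintro ⟨p, hp, hpx⟩
      have hr : r ≤ x.length := by
        have := hpx.length_le
        simp only [Set.mem_ofPred_eq] at hp
        omega
      exact ⟨_, if_pos hr⟩
  have hc : IsPrefixCode {x : List A | x.length = r} := fun u hu v hv h =>
    h.eq_of_length (Eq.trans hu (Eq.symm hv))
  refine ⟨_, rfl, ⟨_, List.finite_length_eq A r, hc.isMaximal_iff.2 fun x => ?_, hd⟩,
    RIHom.exists_im_eq _, ?_⟩
  · refine ⟨List.replicate r default, (x ++ List.replicate r default).take r, ?_,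
      List.take_prefix _ _⟩
    simp
  · intro x₁ x₂ y₁ y₂ h1 h2 h
    simp only [RIHom.prefixMap] at h1 h2
    split_ifs at h1 h2 with h3 h4
    rw [← Option.some.inj h1, ← Option.some.inj h2]
    simp [hf _ (show (x₁.take r).length = r by simpa using h3),
      hf _ (show (x₂.take r).length = r by simpa using h4), h]

theorem acts_prefixMap [Finite A] {r s : ℕ} {f : List A → List A}
    (hf : ∀ u, u.length = r → (f u).length = s) {α β : ℕ → A}
    (h1 : f (pre α r) = pre β s) (h2 : ∀ i, β (s + i) = α (r + i)) :
    (M.mk (RIHom.prefixMap r s f hf)).1.Acts α β (s - r) := by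
  refine RIHom.acts_maxExt.2 ⟨r, s, ?_, h2, by ring⟩
  simp [RIHom.prefixMap, ← h1, List.take_of_length_le]

/-- The transposition `τ_{i+1,j+1}` exchanges the letters at the positions `i` and `j`, counted from
`0`. -/
theorem acts_transposition [Finite A] {i j : ℕ} (hij : i < j) (α : ℕ → A) :
    (M.mk (RIHom.transposition A (i + 1) (j + 1) (by omega) (by omega))).1.Acts α
      (α ∘ Equiv.swap i j) 0 := by
  refine RIHom.acts_maxExt.2 ⟨j + 1, j + 1, ?_, fun t => ?_, by simp⟩
  · simp only [RIHom.transposition, length_pre, le_refl, dite_true, Option.some.injEq]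
    refine List.ext_getElem (by simp) fun t h1 h2 => ?_
    simp only [List.getElem_set, getElem_pre, Function.comp_apply, Nat.add_sub_cancel]
    split_ifs with h h'
    · rw [← h, Equiv.swap_apply_right]
    · rw [← h', Equiv.swap_apply_left]
    · rw [Equiv.swap_apply_of_ne_of_ne (Ne.symm h') (Ne.symm h)]
  · rw [Function.comp_apply, Equiv.swap_apply_of_ne_of_ne (by omega) (by omega)]

/-! ### Maps of infinite words realized by short words over a set of generators -/

/-- Some word of length at most `n` over `S` acts on every infinite word `α` by taking it to `F α`,
with change of length `d`. -/
def Realizes (S : Set (M A)) (n : ℕ) (F : (ℕ → A) → ℕ → A) (d : ℤ) : Prop :=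
  ∃ w : List (M A), (∀ s ∈ w, s ∈ S) ∧ w.length ≤ n ∧ ∀ α, w.prod.1.Acts α (F α) d

/-- Performing `C t` for `t = 0, …, n - 1` in turn. -/
def sweep (C : ℕ → (ℕ → A) → ℕ → A) : ℕ → (ℕ → A) → ℕ → A
  | 0 => fun α => α
  | n + 1 => fun α => C n (sweep C n α)

namespace Realizes

variable {S : Set (M A)} {m n : ℕ} {F G : (ℕ → A) → ℕ → A} {d d' : ℤ}

theorem mono (h : Realizes S m F d) (hmn : m ≤ n) : Realizes S n F d := by
  obtain ⟨w, h1, h2, h3⟩ := h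
  exact ⟨w, h1, h2.trans hmn, h3⟩

theorem refl (S : Set (M A)) (n : ℕ) : Realizes S n (fun α => α) 0 :=
  ⟨[], by simp, by simp, fun α => acts_one α⟩

theorem comp (hG : Realizes S n G d') (hF : Realizes S m F d) :
    Realizes S (n + m) (fun α => G (F α)) (d + d') := by
  obtain ⟨w, h1, h2, h3⟩ := hF
  obtain ⟨w', h1', h2', h3'⟩ := hG
  refine ⟨w' ++ w, fun s hs => ?_, by simp; omega, fun α => ?_⟩
  · rcases List.mem_append.1 hs with h | h
    · exact h1' s h
    · exact h1 s h
  · rw [List.prod_append]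
    exact acts_mul.2 ⟨_, _, _, h3 α, h3' _, rfl⟩

theorem iterate (hF : Realizes S m F d) (t : ℕ) : Realizes S (t * m) F^[t] (t * d) := by
  induction t with
  | zero => simpa using! refl S 0
  | succ t ih =>
    have := ih.comp hF
    rw [show t * m + m = (t + 1) * m by ring,
      show d + t * d = ((t + 1 : ℕ) : ℤ) * d by push_cast; ring] at this
    exact this

theorem of_mem_closure {g : M A} (hg : g ∈ Submonoid.closure S)
    (h : ∀ α, g.1.Acts α (F α) d) : ∃ n, Realizes S n F d := by
  obtain ⟨w, hw, rfl⟩ := Submonoid.exists_list_of_mem_closure hg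
  exact ⟨w.length, w, hw, le_rfl, h⟩

/-- The action on infinite words determines the element, so a word that acts like `g` represents
`g`. -/
theorem wordLength_le [Inhabited A] (h : Realizes S n F d) {g : M A}
    (hg : ∀ α, g.1.Acts α (F α) d) : wordLength S g ≤ n := by
  obtain ⟨w, h1, h2, h3⟩ := h
  obtain rfl : w.prod = g := M.ext_acts fun α => ⟨_, _, h3 α, hg α⟩
  have hmem : w.length ∈ {n | ∃ v : List (M A), (∀ s ∈ v, s ∈ S) ∧ v.prod = w.prod ∧
    v.length = n} := ⟨w, h1, rfl, rfl⟩
  exact (Nat.sInf_le hmem).trans h2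

theorem congr (h : Realizes S n F d) (hFG : ∀ α, F α = G α) : Realizes S n G d :=
  funext hFG ▸ h

theorem sweep {C : ℕ → (ℕ → A) → ℕ → A} {n : ℕ} (h : ∀ t < n, Realizes S m (C t) 0) :
    Realizes S (n * m) (ThompsonHigman.sweep C n) 0 := by
  induction n with
  | zero => exact (refl S 0).mono (Nat.zero_le _)
  | succ n ih =>
    have := (h n (Nat.lt_succ_self n)).comp (ih fun t ht => h t (Nat.lt_succ_of_lt ht))
    rw [add_zero, add_comm, ← Nat.succ_mul] at this
    exact this

end Realizes

/-- In a sweep in which only one operation is effective, only this one has to be performed. -/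
theorem sweep_eq {C : ℕ → (ℕ → A) → ℕ → A} {α : ℕ → A} {q n : ℕ} (hq : q < n)
    (h1 : ∀ t < n, t ≠ q → C t α = α) (h2 : ∀ t < n, t ≠ q → C t (C q α) = C q α) :
    sweep C n α = C q α := by
  have key : ∀ m ≤ n, sweep C m α = if q < m then C q α else α := by
    intro m hm
    induction m with
    | zero => simp [sweep]
    | succ m ih =>
      simp only [sweep, ih (by omega)]
      rcases lt_trichotomy q m with h | rfl | h
      · rw [if_pos h, if_pos (by omega), h2 _ (by omega) h.ne']
      · simp
      · rw [if_neg (by omega), if_neg (by omega), h1 _ (by omega) h.ne]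
  rw [key n le_rfl, if_pos hq]

/-- Application of `H` to the letters at the positions `ι j`. -/
noncomputable def gate {J : Type*} (H : (J → A) → J → A) (ι : J → ℕ) (α : ℕ → A) : ℕ → A :=
  Function.extend ι (H (α ∘ ι)) α

theorem gate_apply {J : Type*} {H : (J → A) → J → A} {ι : J → ℕ} (hι : ι.Injective)
    (α : ℕ → A) (j : J) : gate H ι α (ι j) = H (α ∘ ι) j :=
  hι.extend_apply _ _ _

theorem gate_apply_of_ne {J : Type*} {H : (J → A) → J → A} {ι : J → ℕ}
    (α : ℕ → A) {i : ℕ} (h : ∀ j, ι j ≠ i) : gate H ι α i = α i :=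
  Function.extend_apply' _ _ _ fun ⟨j, hj⟩ => h j hj

theorem gate_of_fixed {J : Type*} {H : (J → A) → J → A} {ι : J → ℕ} (hι : ι.Injective)
    {α : ℕ → A} (h : H (α ∘ ι) = α ∘ ι) : gate H ι α = α := by
  funext i
  by_cases hi : ∃ j, ι j = i
  · obtain ⟨j, rfl⟩ := hi
    rw [gate_apply hι, h, Function.comp_apply]
  · exact gate_apply_of_ne α fun j hj => hi ⟨j, hj⟩

section Gates

variable [Finite A] {S : Set (M A)}

theorem realizes_swap (hS : transpositions A ⊆ S) (i j : ℕ) :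
    Realizes S 1 (fun α => α ∘ Equiv.swap i j) 0 := by
  have key : ∀ i j : ℕ, i < j → Realizes S 1 (fun α => α ∘ Equiv.swap i j) 0 := fun i j h =>
    ⟨[M.mk (RIHom.transposition A (i + 1) (j + 1) (by omega) (by omega))],
      by simpa using hS ⟨_, _, _, _, rfl⟩, by simp, by simpa using acts_transposition h⟩
  rcases lt_trichotomy i j with h | rfl | h
  · exact key i j h
  · exact (Realizes.refl S 1).congr fun α => by simp
  · rw [Equiv.swap_comm]
    exact key j i h

/-- Some product of at most `r` transpositions takes the first `r` positions to given distinct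
positions. -/
theorem exists_perm_realizes (hS : transpositions A ⊆ S) (r : ℕ) (ι : ℕ → ℕ)
    (hι : Set.InjOn ι (Set.Iio r)) : ∃ π : Equiv.Perm ℕ, (∀ i < r, π i = ι i) ∧
      Realizes S r (fun α => α ∘ π) 0 ∧ Realizes S r (fun α => α ∘ π.symm) 0 := by
  induction r with
  | zero => exact ⟨1, by simp, Realizes.refl S 0, Realizes.refl S 0⟩
  | succ r ih =>
    obtain ⟨π, h1, h2, h3⟩ := ih (hι.mono fun i hi => Nat.lt_succ_of_lt hi)
    refine ⟨Equiv.swap (π r) (ι r) * π, fun i hi => ?_, ?_, ?_⟩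
    · rw [Equiv.Perm.mul_apply]
      rcases Nat.lt_succ_iff_lt_or_eq.1 hi with h | rfl
      · rw [← h1 i h]
        refine Equiv.swap_apply_of_ne_of_ne (fun e => h.ne (π.injective e)) fun e => ?_
        rw [h1 i h] at e
        exact h.ne (hι hi (Nat.lt_succ_self r) e)
      · exact Equiv.swap_apply_left _ _
    · exact (h2.comp (realizes_swap hS (π r) (ι r))).congr fun α => rfl
    · have := (realizes_swap hS (π r) (ι r)).comp h3
      rw [add_comm 1 r] at this
      exact this.congr fun α => rfl

/-- A fixed map of finitely many letters is performed at arbitrary positions by words of bounded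
length: transpositions bring the letters to the front and back. -/
theorem exists_realizes_gate [Inhabited A] (hS : transpositions A ⊆ S)
    (hlep : lepM A ≤ Submonoid.closure S) {J : Type*} [Finite J] (H : (J → A) → J → A) :
    ∃ n, ∀ ι : J → ℕ, ι.Injective → Realizes S n (gate H ι) 0 := by
  obtain ⟨r, ⟨e⟩⟩ := Finite.exists_equiv_fin J
  -- the map of words of length `r` that corresponds to `H`
  let f : List A → List A := fun u =>
    List.ofFn fun t : Fin r => H (fun j => u.getD (e j) default) (e.symm t)
  have hf : ∀ u : List A, u.length = r → (f u).length = r := by simp [f]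
  have hbase : ∀ α, (M.mk (RIHom.prefixMap r r f hf)).1.Acts α
      (gate H (fun j => (e j : ℕ)) α) 0 := by
    intro α
    have hinj : Function.Injective fun j => (e j : ℕ) := Fin.val_injective.comp e.injective
    rw [← sub_self (r : ℤ)]
    refine acts_prefixMap hf (List.ext_getElem (by simp [f]) fun t h1 h2 => ?_) fun i => ?_
    · simp only [length_pre] at h2
      have h3 := gate_apply (H := H) hinj α (e.symm ⟨t, h2⟩)
      simp only [Equiv.apply_symm_apply] at h3
      simp only [f, List.getElem_ofFn, getElem_pre, h3]
      congr 1
      funext j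
      simp [List.getD_eq_getElem?_getD]
    · exact gate_apply_of_ne α fun j => by have := (e j).2; omega
  obtain ⟨n, hn⟩ := Realizes.of_mem_closure (hlep (mk_prefixMap_mem_lepM hf)) hbase
  refine ⟨r + (n + r), fun ι hι => ?_⟩
  obtain ⟨π, h1, h2, h3⟩ := exists_perm_realizes hS r
    (fun t => if h : t < r then ι (e.symm ⟨t, h⟩) else 0) (by
      intro a ha b hb hab
      simp only [Set.mem_Iio] at ha hb
      exact congrArg Fin.val (e.symm.injective (hι (by simpa [ha, hb] using hab))))
  have hπ : ∀ j, π (e j) = ι j := fun j => by simp [h1 _ (e j).2]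
  refine (h3.comp (hn.comp h2)).congr fun α => funext fun i => ?_
  have hinj : Function.Injective fun j => (e j : ℕ) := Fin.val_injective.comp e.injective
  by_cases hi : ∃ j, ι j = i
  · obtain ⟨j, rfl⟩ := hi
    rw [gate_apply hι, Function.comp_apply, ← hπ, π.symm_apply_apply, gate_apply hinj]
    congr 1
    funext j
    simp [hπ]
  · rw [gate_apply_of_ne α fun j hj => hi ⟨j, hj⟩, Function.comp_apply, gate_apply_of_ne,
      Function.comp_apply, π.apply_symm_apply]
    intro j hj
    exact hi ⟨j, by rw [← hπ, hj, π.apply_symm_apply]⟩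

/-- Insertion of `m` letters `a` at the front. -/
theorem exists_realizes_insert [Inhabited A] (hlep : lepM A ≤ Submonoid.closure S) (a : A) :
    ∃ n, ∀ m : ℕ, Realizes S (m * n) (cat (List.replicate m a)) m := by
  obtain ⟨n, hn⟩ := Realizes.of_mem_closure (F := cat [a]) (d := 1)
    (hlep (mk_prefixMap_mem_lepM (r := 0) (s := 1) (f := fun _ => [a]) (by simp))) fun α => by
      have := acts_prefixMap (r := 0) (s := 1) (f := fun _ => [a]) (by simp) (α := α)
        (β := cat [a] α) (by simp [pre, cat]) (fun i => by simp [cat])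
      simpa using this
  refine ⟨n, fun m => ?_⟩
  have := hn.iterate m
  rw [mul_one] at this
  refine this.congr fun α => ?_
  induction m with
  | zero => funext i; simp [cat]
  | succ m ih =>
    rw [Function.iterate_succ_apply', ih (by simpa using hn.iterate m)]
    funext i
    cases i <;> simp [cat, List.replicate_succ]

/-- Deletion of the first `m` letters. -/
theorem exists_realizes_delete [Inhabited A] (hlep : lepM A ≤ Submonoid.closure S) :
    ∃ n, ∀ m : ℕ, Realizes S (m * n) (fun α i => α (m + i)) (-m) := by
  obtain ⟨n, hn⟩ := Realizes.of_mem_closure (F := fun α i => α (1 + i)) (d := -1)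
    (hlep (mk_prefixMap_mem_lepM (r := 1) (s := 0) (f := fun _ => []) (by simp))) fun α => by
      have := acts_prefixMap (r := 1) (s := 0) (f := fun _ => []) (by simp) (α := α)
        (β := fun i => α (1 + i)) (by simp [pre]) (fun i => by simp)
      simpa using this
  refine ⟨n, fun m => ?_⟩
  have := hn.iterate m
  rw [mul_neg_one] at this
  refine this.congr fun α => ?_
  clear this
  induction m with
  | zero => funext i; simp
  | succ m ih =>
    rw [Function.iterate_succ_apply', ih]
    funext i
    simp only
    congr 1
    omega

end Gates

/-! ### Simulation of the generators of `M_{k,1}` -/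

/-- The infinite word `σ` stores the infinite word `α` at the offset `p`. The first `D` letters of
`σ` are flags, and the one at position `p` is the only one that is raised (`a₁` instead of `a₀`).
The next `D` letters are flags that are all down. The tape follows, and `α` is written on it from
its `p`-th letter on; the letters to the left are irrelevant. -/
structure Stores (a₀ a₁ : A) (D : ℕ) (σ α : ℕ → A) (p : ℕ) : Prop where
  flag : ∀ i < D, σ i = if i = p then a₁ else a₀
  clear : ∀ i < D, σ (D + i) = a₀
  tape : ∀ i, σ (2 * D + p + i) = α i

open Classical in
/-- On three letters: exchange the last two if the first one is `a₁`. -/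
noncomputable def condSwap (a₁ : A) (f : Fin 3 → A) : Fin 3 → A :=
  if f 0 = a₁ then f ∘ Equiv.swap 1 2 else f

theorem gate_condSwap_of_ne {a₁ : A} {ι : Fin 3 → ℕ} (hι : ι.Injective) {σ : ℕ → A}
    (h : σ (ι 0) ≠ a₁) : gate (condSwap a₁) ι σ = σ :=
  gate_of_fixed hι (if_neg h)

theorem gate_condSwap_of_eq {a₁ : A} {ι : Fin 3 → ℕ} (hι : ι.Injective) {σ : ℕ → A}
    (h : σ (ι 0) = a₁) : gate (condSwap a₁) ι σ = σ ∘ Equiv.swap (ι 1) (ι 2) := by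
  funext i
  by_cases hi : ∃ j, ι j = i
  · obtain ⟨j, rfl⟩ := hi
    rw [gate_apply hι, condSwap, if_pos (by exact h), Function.comp_apply, Function.comp_apply,
      Function.comp_apply, hι.map_swap]
  · rw [gate_apply_of_ne σ fun j hj => hi ⟨j, hj⟩, Function.comp_apply,
      Equiv.swap_apply_of_ne_of_ne (fun e => hi ⟨1, e.symm⟩) (fun e => hi ⟨2, e.symm⟩)]

/-- A position transposition of the stored word is carried out, for every possible offset, by a
transposition of the tape that is subject to the flag of this offset. -/
theorem exists_realizes_stored_swap [Finite A] [Inhabited A] {S : Set (M A)}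
    (hS : transpositions A ⊆ S) (hlep : lepM A ≤ Submonoid.closure S) {a₀ a₁ : A} (ha : a₀ ≠ a₁) :
    ∃ K, ∀ D i j : ℕ, i ≠ j → ∃ F, Realizes S (D * K) F 0 ∧ ∀ σ α p, p < D →
      Stores a₀ a₁ D σ α p → Stores a₀ a₁ D (F σ) (α ∘ Equiv.swap i j) p := by
  obtain ⟨K, hK⟩ := exists_realizes_gate hS hlep (condSwap a₁)
  refine ⟨K, fun D i j hij => ?_⟩
  have hι : ∀ t < D, Function.Injective ![t, 2 * D + t + i, 2 * D + t + j] := by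
    intro t ht x y hxy
    fin_cases x <;> fin_cases y <;> simp at hxy ⊢ <;> omega
  refine ⟨_, Realizes.sweep fun t ht => hK _ (hι t ht), fun σ α p hp h => ?_⟩
  have hC := gate_condSwap_of_eq (a₁ := a₁) (σ := σ) (hι p hp)
    (by simpa using h.flag p hp)
  simp only [Matrix.cons_val_one, Matrix.cons_val_zero, Matrix.cons_val] at hC
  -- the flags are not affected
  have hlow : ∀ t < 2 * D,
      (σ ∘ Equiv.swap (2 * D + p + i) (2 * D + p + j)) t = σ t := fun t ht => by
    rw [Function.comp_apply, Equiv.swap_apply_of_ne_of_ne (by omega) (by omega)]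
  rw [sweep_eq hp
    (fun t ht hne => gate_condSwap_of_ne (hι t ht) (by simpa [h.flag t ht, hne] using ha))
    (fun t ht hne => gate_condSwap_of_ne (hι t ht) (by
      rw [hC, Matrix.cons_val_zero, hlow t (by omega), h.flag t ht, if_neg hne]
      exact ha)), hC]
  refine ⟨fun t ht => ?_, fun t ht => ?_, fun t => ?_⟩
  · rw [hlow t (by omega), h.flag t ht]
  · rw [hlow (D + t) (by omega), h.clear t ht]
  · have e : Equiv.swap (2 * D + p + i) (2 * D + p + j) (2 * D + p + t) =
        2 * D + p + Equiv.swap i j t :=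
      (Function.Injective.map_swap (f := fun t => 2 * D + p + t) (add_right_injective _) i j t).symm
    rw [Function.comp_apply, e, h.tape, Function.comp_apply]

/-- Exchange of the two banks of `D` flags. -/
theorem realizes_exchange [Finite A] {S : Set (M A)} (hS : transpositions A ⊆ S) (D : ℕ) :
    ∃ F, Realizes S D F 0 ∧ ∀ σ : ℕ → A, (∀ i < D, F σ i = σ (D + i)) ∧
      (∀ i < D, F σ (D + i) = σ i) ∧ ∀ i, F σ (2 * D + i) = σ (2 * D + i) := by
  have key : ∀ n ≤ D, ∀ (σ : ℕ → A) (i : ℕ),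
      sweep (fun t σ => σ ∘ Equiv.swap t (D + t)) n σ i =
        if i < n then σ (D + i) else if D ≤ i ∧ i < D + n then σ (i - D) else σ i := by
    intro n hn σ
    induction n with
    | zero =>
      intro i
      rw [if_neg (by omega), if_neg (by omega), sweep]
    | succ n ih =>
      intro i
      simp only [sweep, Function.comp_apply, Equiv.swap_apply_def]
      split_ifs <;> (try omega) <;> rw [ih (by omega)] <;> split_ifs <;>
        first | omega | rfl | (congr 1; omega)
  refine ⟨_, (Realizes.sweep (n := D) fun t _ => realizes_swap hS t (D + t)).mono (by simp),
    fun σ => ⟨fun i hi => ?_, fun i hi => ?_, fun i => ?_⟩⟩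
  · rw [key D le_rfl, if_pos hi]
  · rw [key D le_rfl, if_neg (by omega), if_pos (by omega), Nat.add_sub_cancel_left]
  · rw [key D le_rfl, if_neg (by omega), if_neg (by omega)]

/-- If `φ` acts on an infinite word at all, it is defined on every prefix whose length `b` is large
enough, and its value has length at most `2 b`. -/
theorem RIHom.exists_window (φ : RIHom A) : ∃ r, ∀ b, r ≤ b → ∀ α β d, φ.Acts α β d →
    ∃ v, φ.toFun (pre α b) = some v ∧ v.length ≤ 2 * b ∧
      β = cat v (fun i => α (b + i)) ∧ d = v.length - b := by
  obtain ⟨P, hP, hd⟩ := φ.fg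
  obtain ⟨r₁, h₁⟩ := (hP.image List.length).bddAbove
  obtain ⟨r₂, h₂⟩ := (hP.image fun p => ((φ.toFun p).getD []).length).bddAbove
  refine ⟨max r₁ r₂, fun b hb α β d h => ?_⟩
  obtain ⟨m, n, hm, -, hφ, -, -⟩ := h.exists_ge b
  have hdom : pre α m ∈ genIdeal P := by
    rw [← hd]
    exact ⟨_, hφ⟩
  obtain ⟨p, hp, hpm⟩ := hdom
  have hpl : p.length ≤ r₁ := h₁ ⟨p, hp, rfl⟩
  have hpd : p ∈ {x | ∃ y, φ.toFun x = some y} := by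
    rw [hd]
    exact ⟨p, hp, List.prefix_rfl⟩
  obtain ⟨v, hv⟩ := hpd
  have hvl : v.length ≤ r₂ := by simpa [hv] using h₂ ⟨p, hp, rfl⟩
  have hrb := max_le_iff.1 hb
  obtain ⟨z, hz⟩ := List.prefix_of_prefix_length_le hpm (pre_prefix α hm) (by simp; omega)
  have hzl : p.length + z.length = b := by simpa using congrArg List.length hz
  have hval : φ.toFun (pre α b) = some (v ++ z) := by rw [← hz, φ.map_append _ _ z hv]
  have hacts := acts_of_eq hval (fun i => α (b + i))
  rw [← eq_cat_pre, length_pre] at hacts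
  obtain ⟨e1, e2⟩ := h.unique hacts
  exact ⟨_, hval, by simp; omega, e1, e2⟩

/-- The letters involved in the application of a homomorphism at a given offset `p`, with a window
of width `b`: the flag of `p`, the flags of `p - b, …, p + b` in the second bank, and the letters
`p - b, …, p + b - 1` of the tape. -/
abbrev Window (b : ℕ) : Type := Unit ⊕ Fin (2 * b + 1) ⊕ Fin (2 * b)

/-- The positions of the letters of the window around the offset `q + b`. -/
def windowPos (b D q : ℕ) : Window b → ℕ
  | .inl _ => q + b
  | .inr (.inl s) => D + (q + s)
  | .inr (.inr s) => 2 * D + (q + s)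

theorem windowPos_injective {b D q : ℕ} (h : q + 2 * b < D) : (windowPos b D q).Injective := by
  rintro (_ | s | s) (_ | t | t) h' <;> simp only [windowPos] at h'
  · rfl
  · omega
  · omega
  · omega
  · rw [Fin.ext (show (s : ℕ) = t by omega)]
  · have := s.2
    omega
  · omega
  · have := t.2
    omega
  · rw [Fin.ext (show (s : ℕ) = t by omega)]

open Classical in
/-- If the flag of the current offset is raised: replace the word `u` of length `b` at this offset
by `v = φ u`, in such a way that the right end stays in place; take down the flag, and raise the
flag of the new offset in the second bank. -/
noncomputable def rewriteWindow (φ : RIHom A) (a₀ a₁ : A) (b : ℕ) (f : Window b → A) :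
    Window b → A :=
  if f (.inl ()) = a₁ then
    match φ.toFun (List.ofFn fun i : Fin b => f (.inr (.inr ⟨b + i, by omega⟩))) with
    | none => f
    | some v => fun
      | .inl _ => a₀
      | .inr (.inl s) => if s + v.length = 2 * b then a₁ else f (.inr (.inl s))
      | .inr (.inr s) =>
        if 2 * b ≤ s + v.length then v.getD (s + v.length - 2 * b) a₀ else f (.inr (.inr s))
  else f

theorem gate_rewriteWindow_of_ne {φ : RIHom A} {a₀ a₁ : A} {b D q : ℕ} (h : q + 2 * b < D)
    {σ : ℕ → A} (hσ : σ (q + b) ≠ a₁) :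
    gate (rewriteWindow φ a₀ a₁ b) (windowPos b D q) σ = σ :=
  gate_of_fixed (windowPos_injective h) (if_neg hσ)

/-- The effect of the rewriting at the offset of the stored word: the second bank shows the new
offset `p`, and the image `φ α` is written on the tape from there on. -/
theorem gate_rewriteWindow {φ : RIHom A} {a₀ a₁ : A} {b D q : ℕ} (hq : q + 2 * b < D)
    {σ α : ℕ → A} (h : Stores a₀ a₁ D σ α (q + b)) {v : List A}
    (hv : φ.toFun (pre α b) = some v) (hvl : v.length ≤ 2 * b) {τ : ℕ → A}
    (hτ : τ = gate (rewriteWindow φ a₀ a₁ b) (windowPos b D q) σ) :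
    (∀ i < D, τ i = a₀) ∧
      (∀ i < D, τ (D + i) = if i + v.length = q + 2 * b then a₁ else a₀) ∧
      ∀ p i, p + v.length = q + 2 * b →
        τ (2 * D + p + i) = cat v (fun i => α (b + i)) i := by
  have hinj := windowPos_injective hq
  have hword : (List.ofFn fun i : Fin b =>
      (σ ∘ windowPos b D q) (.inr (.inr ⟨b + i, by omega⟩))) = pre α b :=
    List.ext_getElem (by simp) fun i h1 h2 => by
      simp only [List.getElem_ofFn, getElem_pre, Function.comp_apply, windowPos]
      rw [← h.tape]
      congr 1
      omega
  have hval : ∀ j, τ (windowPos b D q j) = match j with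
      | .inl _ => a₀
      | .inr (.inl s) => if s + v.length = 2 * b then a₁ else σ (D + (q + s))
      | .inr (.inr s) =>
        if 2 * b ≤ s + v.length then v.getD (s + v.length - 2 * b) a₀
        else σ (2 * D + (q + s)) := by
    intro j
    rw [hτ, gate_apply hinj, rewriteWindow, hword, hv, if_pos]
    · rcases j with _ | s | s <;> rfl
    · simpa [windowPos] using h.flag (q + b) (by omega)
  have hout : ∀ i, (∀ j, windowPos b D q j ≠ i) → τ i = σ i := fun i hi =>
    hτ ▸ gate_apply_of_ne σ hi
  refine ⟨fun i hi => ?_, fun i hi => ?_, fun p i hp => ?_⟩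
  · by_cases e : i = q + b
    · subst e
      exact hval (.inl ())
    · rw [hout, h.flag i hi, if_neg e]
      rintro (_ | s | s) <;> simp only [windowPos] <;> omega
  · by_cases e : q ≤ i ∧ i ≤ q + 2 * b
    · have := hval (.inr (.inl ⟨i - q, by omega⟩))
      simp only [windowPos, Nat.add_sub_cancel' e.1] at this
      rw [this, h.clear i hi]
      refine if_congr ?_ rfl rfl
      omega
    · rw [hout, h.clear i hi, if_neg (by omega)]
      rintro (_ | s | s) <;> simp only [windowPos] <;> omega
  · by_cases e : i < v.length
    · have := hval (.inr (.inr ⟨p + i - q, by omega⟩))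
      simp only [windowPos] at this
      rw [show 2 * D + p + i = 2 * D + (q + (p + i - q)) by omega, this, if_pos (by omega),
        show p + i - q + v.length - 2 * b = i by omega]
      simp [cat, e]
    · rw [hout, show 2 * D + p + i = 2 * D + (q + b) + (b + (i - v.length)) by omega, h.tape]
      · simp [cat, e]
      · rintro (_ | s | s) <;> simp only [windowPos] <;> omega

/-- A fixed homomorphism `φ` is applied to the stored word, for every possible offset, by a
rewriting of the tape that is subject to the flag of this offset. The second bank of flags keeps
the new offset from being treated again during the same sweep. -/
theorem exists_realizes_stored_map [Finite A] [Inhabited A] {S : Set (M A)}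
    (hS : transpositions A ⊆ S) (hlep : lepM A ≤ Submonoid.closure S) {a₀ a₁ : A} (ha : a₀ ≠ a₁)
    (φ : RIHom A) : ∃ r, ∀ b, r ≤ b → ∃ K, ∀ n D : ℕ, n + 2 * b ≤ D →
      ∃ F, Realizes S (D * K) F 0 ∧ ∀ σ α β d q, q < n → Stores a₀ a₁ D σ α (q + b) →
        φ.Acts α β d → |d| ≤ b ∧ ∀ p : ℕ, (p : ℤ) = q + b - d → Stores a₀ a₁ D (F σ) β p := by
  obtain ⟨r, hr⟩ := φ.exists_window
  refine ⟨r, fun b hb => ?_⟩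
  obtain ⟨K, hK⟩ := exists_realizes_gate hS hlep (rewriteWindow φ a₀ a₁ b)
  refine ⟨1 + K, fun n D hD => ?_⟩
  obtain ⟨E, hE, hEσ⟩ := realizes_exchange hS D
  refine ⟨_, (hE.comp (Realizes.sweep (n := n) fun t ht =>
    hK _ (windowPos_injective (q := t) (D := D) (by omega)))).mono ?_,
    fun σ α β d q hq h hφ => ?_⟩
  · rw [mul_add, mul_one]
    gcongr
    omega
  obtain ⟨v, hv, hvl, rfl, rfl⟩ := hr b hb α β d hφ
  refine ⟨abs_le.2 ⟨by omega, by omega⟩, fun p hp => ?_⟩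
  obtain ⟨h1, h2, h3⟩ := gate_rewriteWindow (by omega) h hv hvl rfl
  rw [sweep_eq hq
    (fun t ht hne => gate_rewriteWindow_of_ne (by omega)
      (by rw [h.flag _ (by omega), if_neg (by omega)]; exact ha))
    (fun t ht hne => gate_rewriteWindow_of_ne (by omega)
      (by rw [h1 _ (by omega)]; exact ha))]
  obtain ⟨e1, e2, e3⟩ := hEσ (gate (rewriteWindow φ a₀ a₁ b) (windowPos b D q) σ)
  refine ⟨fun i hi => ?_, fun i hi => ?_, fun i => ?_⟩
  · rw [e1 i hi, h2 i hi]
    refine if_congr ?_ rfl rfl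
    omega
  · rw [e2 i hi, h1 i hi]
  · rw [add_assoc, e3, ← add_assoc, h3 p i (by omega)]

/-! ### Simulation of words -/

variable {S Γ : Set (M A)} {a₀ a₁ : A}

theorem exists_bound_of_finite {ι : Type*} {s : Set ι} (hs : s.Finite) {p : ι → ℕ → Prop}
    (h : ∀ i, ∃ n, p i n) (hp : ∀ i m n, m ≤ n → p i m → p i n) : ∃ n, ∀ i ∈ s, p i n := by
  choose f hf using h
  obtain ⟨n, hn⟩ := (hs.image f).bddAbove
  exact ⟨n, fun i hi => hp i _ _ (hn ⟨i, hi, rfl⟩) (hf i)⟩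

/-- Every generator is simulated with a number of steps that is linear in the number of flags. -/
theorem exists_realizes_stored_generator [Finite A] [Inhabited A] (hS : transpositions A ⊆ S)
    (hlep : lepM A ≤ Submonoid.closure S) (ha : a₀ ≠ a₁) (hΓ : Γ.Finite) :
    ∃ b K, ∀ n D : ℕ, n + 2 * b ≤ D → ∀ g ∈ Γ ∪ transpositions A,
      ∃ F, Realizes S (D * K) F 0 ∧ ∀ σ α β d q, q < n → Stores a₀ a₁ D σ α (q + b) →
        g.1.Acts α β d → |d| ≤ b ∧ ∀ p : ℕ, (p : ℤ) = q + b - d → Stores a₀ a₁ D (F σ) β p := by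
  obtain ⟨b, hb⟩ := exists_bound_of_finite hΓ
    (fun g => exists_realizes_stored_map hS hlep ha g.1)
    fun g m n hmn h b hb => h b (hmn.trans hb)
  obtain ⟨K₁, hK₁⟩ := exists_bound_of_finite (s := Γ) (p := fun g K => g ∈ Γ → _) hΓ
    (fun g => by
      by_cases hg : g ∈ Γ
      · obtain ⟨K, hK⟩ := hb g hg b le_rfl
        exact ⟨K, fun _ => hK⟩
      · exact ⟨0, fun h => (hg h).elim⟩)
    fun g m n hmn h hg N D hD => by
      obtain ⟨F, h1, h2⟩ := h hg N D hD
      exact ⟨F, h1.mono (Nat.mul_le_mul_left D hmn), h2⟩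
  obtain ⟨K₂, hK₂⟩ := exists_realizes_stored_swap hS hlep ha
  refine ⟨b, max K₁ K₂, fun n D hD g hg => ?_⟩
  rcases hg with hg | ⟨i, j, hi, hij, rfl⟩
  · obtain ⟨F, h1, h2⟩ := hK₁ g hg hg n D hD
    exact ⟨F, h1.mono (Nat.mul_le_mul_left D (le_max_left _ _)), h2⟩
  · obtain ⟨i, rfl⟩ := Nat.exists_eq_add_of_le' hi
    obtain ⟨j, rfl⟩ := Nat.exists_eq_add_of_le' (show 1 ≤ j by omega)
    obtain ⟨F, h1, h2⟩ := hK₂ D i j (by omega)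
    refine ⟨F, h1.mono (Nat.mul_le_mul_left D (le_max_right _ _)), fun σ α β d q hq h hd => ?_⟩
    obtain ⟨rfl, rfl⟩ := hd.unique (acts_transposition (by omega) α)
    refine ⟨by simp, fun p hp => ?_⟩
    obtain rfl : p = q + b := by omega
    exact h2 σ α _ (by omega) h

/-- The offset stays within the range that the flags cover, because each generator moves it by at
most `b`. -/
theorem exists_realizes_stored_word {b K n D : ℕ}
    (hgen : ∀ g ∈ Γ, ∃ F, Realizes S (D * K) F 0 ∧ ∀ σ α β d q, q < n →
      Stores a₀ a₁ D σ α (q + b) → g.1.Acts α β d →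
      |d| ≤ b ∧ ∀ p : ℕ, (p : ℤ) = q + b - d → Stores a₀ a₁ D (F σ) β p)
    (w : List (M A)) (hw : ∀ g ∈ w, g ∈ Γ) :
    ∃ F, Realizes S (w.length * (D * K)) F 0 ∧ ∀ σ α β d q, w.length * b ≤ q →
      q + w.length * b < n → Stores a₀ a₁ D σ α (q + b) → w.prod.1.Acts α β d →
      |d| ≤ w.length * b ∧ ∀ p : ℕ, (p : ℤ) = q + b - d → Stores a₀ a₁ D (F σ) β p := by
  induction w with
  | nil =>
    refine ⟨_, Realizes.refl S _, fun σ α β d q _ _ h hd => ?_⟩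
    obtain ⟨rfl, rfl⟩ := acts_one_iff.1 hd
    refine ⟨by simp, fun p hp => ?_⟩
    obtain rfl : p = q + b := by omega
    exact h
  | cons g w ih =>
    obtain ⟨F, h1, h2⟩ := ih fun g hg => hw g (List.mem_cons_of_mem _ hg)
    obtain ⟨G, h3, h4⟩ := hgen g (hw g List.mem_cons_self)
    refine ⟨_, (h3.comp h1).mono (by rw [List.length_cons, Nat.succ_mul, add_comm]),
      fun σ α γ d q hq hqn h hd => ?_⟩
    rw [List.prod_cons] at hd
    obtain ⟨β, d₁, d₂, hd₁, hd₂, rfl⟩ := acts_mul.1 hd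
    rw [List.length_cons, Nat.succ_mul] at hq hqn
    obtain ⟨h5, h6⟩ := h2 σ α β d₁ q (by omega) (by omega) h hd₁
    have h5' : |d₁| ≤ ((w.length * b : ℕ) : ℤ) := by exact_mod_cast h5
    obtain ⟨h7, h8⟩ := abs_le.1 h5'
    obtain ⟨q', hq'⟩ := Int.eq_ofNat_of_zero_le (show 0 ≤ (q : ℤ) - d₁ by omega)
    obtain ⟨h9, h10⟩ := h4 _ β γ d₂ q' (by omega) (h6 (q' + b) (by push_cast; omega)) hd₂
    refine ⟨?_, fun p hp => h10 p (by omega)⟩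
    have := abs_add_le d₁ d₂
    rw [List.length_cons]
    push_cast
    linarith

/-- A word of length `N` that represents an element of `lepM_{k,1}` is replaced by a word of
length `O(N²)` that does not leave `lepM_{k,1}`. -/
theorem exists_wordLength_le_mul_sq [Finite A] [Inhabited A] (hS : transpositions A ⊆ S)
    (hlep : lepM A ≤ Submonoid.closure S) (ha : a₀ ≠ a₁) (hΓ : Γ.Finite) :
    ∃ c : ℕ, ∀ w : List (M A), (∀ g ∈ w, g ∈ Γ ∪ transpositions A) → w.prod ∈ lepM A →
      wordLength S w.prod ≤ c * w.length ^ 2 := by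
  obtain ⟨b, K, hgen⟩ := exists_realizes_stored_generator hS hlep ha hΓ
  obtain ⟨cI, hI⟩ := exists_realizes_insert hlep a₀
  obtain ⟨cD, hD⟩ := exists_realizes_delete hlep
  obtain ⟨cS, hset⟩ := exists_realizes_gate hS hlep (fun _ : Unit → A => fun _ => a₁)
  refine ⟨3 * (4 * b + 1) * cD + ((4 * b + 1) * K + (cS + 3 * (4 * b + 1) * cI)),
    fun w hw hwlep => ?_⟩
  rcases Nat.eq_zero_or_pos w.length with h0 | hN
  · obtain rfl := List.length_eq_zero_iff.1 h0
    exact (Realizes.refl S 0).wordLength_le acts_one |>.trans (Nat.zero_le _)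
  obtain ⟨d, hd⟩ := exists_acts_of_mem_lepM hwlep
  choose β hβ using hd
  set N := w.length with hNdef
  -- `N` steps change the offset by at most `N * b` in either direction
  set n := 2 * (N * b) + 1 with hn
  set D := n + 2 * b with hDdef
  set p := N * b + b with hp
  obtain ⟨F, hF, hFσ⟩ := exists_realizes_stored_word (hgen n D le_rfl) w hw
  rw [← hNdef] at hF hFσ
  have hinj : Function.Injective fun _ : Unit => p := fun _ _ _ => rfl
  have hinit : ∀ α, Stores a₀ a₁ D
      (gate (fun _ _ => a₁) (fun _ : Unit => p) (cat (List.replicate (2 * D + p) a₀) α)) α p := by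
    intro α
    refine ⟨fun i hi => ?_, fun i hi => ?_, fun i => ?_⟩
    · split_ifs with h
      · subst h
        exact gate_apply hinj _ ()
      · rw [gate_apply_of_ne _ fun _ => Ne.symm h]
        simp [cat, show i < 2 * D + p by omega]
    · rw [gate_apply_of_ne _ fun _ => by omega]
      simp [cat, show D + i < 2 * D + p by omega]
    · rw [gate_apply_of_ne _ fun _ => by omega]
      simp [cat]
  have hfinal := fun α => hFσ _ α (β α) d (N * b) le_rfl (by omega) (hinit α) (hβ α)
  have hdb : |d| ≤ ((N * b : ℕ) : ℤ) := by exact_mod_cast (hfinal fun _ => default).1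
  obtain ⟨hd1, hd2⟩ := abs_le.1 hdb
  -- the final offset does not depend on the infinite word
  obtain ⟨p', hp'⟩ := Int.eq_ofNat_of_zero_le (show 0 ≤ (p : ℤ) - d by omega)
  have hreal := (hD (2 * D + p')).comp (hF.comp ((hset _ hinj).comp (hI (2 * D + p))))
  rw [show ((2 * D + p : ℕ) : ℤ) + 0 + 0 + -((2 * D + p' : ℕ) : ℤ) = d by push_cast; omega]
    at hreal
  have hle := (hreal.congr (G := β) fun α => funext fun i =>
    ((hfinal α).2 p' (by push_cast [hp] at hp' ⊢; omega)).tape i).wordLength_le hβ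
  refine hle.trans ?_
  have hb : b ≤ N * b := Nat.le_mul_of_pos_left b hN
  have e : N * (4 * b + 1) = 4 * (N * b) + N := by ring
  have hNN : N ≤ N ^ 2 := Nat.le_self_pow two_ne_zero N
  calc (2 * D + p') * cD + (N * (D * K) + (cS + (2 * D + p) * cI))
      ≤ (3 * (N * (4 * b + 1))) * cD + (N * (N * (4 * b + 1) * K) +
        (cS + (3 * (N * (4 * b + 1))) * cI)) := by
        gcongr <;> omega
    _ = N * (3 * (4 * b + 1) * cD) + (N ^ 2 * ((4 * b + 1) * K) +
        (1 * cS + N * (3 * (4 * b + 1) * cI))) := by ring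
    _ ≤ N ^ 2 * (3 * (4 * b + 1) * cD) + (N ^ 2 * ((4 * b + 1) * K) +
        (N ^ 2 * cS + N ^ 2 * (3 * (4 * b + 1) * cI))) := by
        gcongr
        omega
    _ = _ := by ring

/-! ### Word length and distortion -/

theorem exists_word_of_wordLength {G : Type*} [Monoid G] {S : Set G}
    (h : Submonoid.closure S = ⊤) (x : G) :
    ∃ w : List G, (∀ s ∈ w, s ∈ S) ∧ w.prod = x ∧ w.length = wordLength S x := by
  obtain ⟨w, h1, h2⟩ := Submonoid.exists_list_of_mem_closure
    (show x ∈ Submonoid.closure S from h ▸ Submonoid.mem_top x)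
  have hne : {n : ℕ | ∃ w : List G, (∀ s ∈ w, s ∈ S) ∧ w.prod = x ∧ w.length = n}.Nonempty :=
    ⟨_, w, h1, h2, rfl⟩
  exact Nat.sInf_mem hne

theorem distortion_le_mul_sq {G : Type*} {ℓ₁ ℓ₂ : G → ℝ≥0} {c : ℝ≥0}
    (h : ∀ g, ℓ₁ g ≤ c * ℓ₂ g ^ 2) (n : ℝ≥0) :
    distortion ℓ₁ ℓ₂ n ≤ ((c * n ^ 2 : ℝ≥0) : ℝ≥0∞) :=
  iSup₂_le fun g hg => ENNReal.coe_le_coe.2 ((h g).trans (by gcongr))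

end ThompsonHigman

theorem mainTheorem2 (k : ℕ) (hk : 2 ≤ k)
    (ΓM Γlep : Set (ThompsonHigman.M (Fin k)))
    (hΓM : ΓM.Finite) (hΓlep : Γlep.Finite)
    (hgenM : Submonoid.closure (ΓM ∪ ThompsonHigman.transpositions (Fin k)) = ⊤)
    (hgenlep : Submonoid.closure (Γlep ∪ ThompsonHigman.transpositions (Fin k)) =
      ThompsonHigman.lepM (Fin k)) :
    ∃ c : ℝ≥0, 1 ≤ c ∧
      (∀ x ∈ ThompsonHigman.lepM (Fin k),
        (ThompsonHigman.wordLength (Γlep ∪ ThompsonHigman.transpositions (Fin k)) x : ℝ≥0) ≤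
          c * (ThompsonHigman.wordLength
            (ΓM ∪ ThompsonHigman.transpositions (Fin k)) x : ℝ≥0) ^ 2) ∧
      ∀ n : ℝ≥0,
        ThompsonHigman.distortion
          (fun x : ThompsonHigman.lepM (Fin k) => (ThompsonHigman.wordLength
            (Γlep ∪ ThompsonHigman.transpositions (Fin k)) (x : ThompsonHigman.M (Fin k)) : ℝ≥0))
          (fun x : ThompsonHigman.lepM (Fin k) => (ThompsonHigman.wordLength
            (ΓM ∪ ThompsonHigman.transpositions (Fin k)) (x : ThompsonHigman.M (Fin k)) : ℝ≥0))
          n ≤ ((c * n ^ 2 : ℝ≥0) : ℝ≥0∞) := by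
  open ThompsonHigman in
  have : Inhabited (Fin k) := ⟨⟨0, by omega⟩⟩
  have ha : (⟨0, by omega⟩ : Fin k) ≠ ⟨1, by omega⟩ := by simp
  obtain ⟨c, hc⟩ := exists_wordLength_le_mul_sq (S := Γlep ∪ transpositions (Fin k))
    Set.subset_union_right hgenlep.ge ha hΓM
  have key : ∀ x ∈ lepM (Fin k),
      (wordLength (Γlep ∪ transpositions (Fin k)) x : ℝ≥0) ≤
        ((c + 1 : ℕ) : ℝ≥0) * (wordLength (ΓM ∪ transpositions (Fin k)) x : ℝ≥0) ^ 2 := by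
    intro x hx
    obtain ⟨w, hw, rfl, hl⟩ := exists_word_of_wordLength hgenM x
    rw [← hl]
    exact_mod_cast (hc w hw hx).trans (Nat.mul_le_mul_right _ (Nat.le_succ c))
  exact ⟨_, by exact_mod_cast Nat.le_add_left 1 c, key,
    distortion_le_mul_sq fun x => key x x.2⟩
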